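/- Let $\mathbf k$ be a field, $R=\mathbf k[x_1,\dots,x_n]$, and for a monomial ideal $J\subseteq R$ let $G(J)$ be its minimal monomial generating set. Let $I\subseteq R$ be a monomial ideal, and let $a_i$ be the largest exponent of $x_i$ in an element of $G(I)$. Put $S=\mathbf k[x_{i,j}: 1\le i\le n,\ 1\le j\le a_i]$. For a monomial $\mathbf x^b\in R$ with $b\le a$ put $\overline{\mathbf x^b}=\prod_{i=1}^n x_{i,1}x_{i,2}\cdots x_{i,b_i}\in S$ and let $\overline b$ be the exponent vector of $\overline{\mathbf x^b}$. For a monomial ideal $J$ whose minimal generators have exponents $\le a$ let $\overline J=\langle \overline m : m\in G(J)\rangle\subseteq S$; the polarization of $I$ is $I^P=\overline I$. A multigraded complex $\mathbb F:\cdots\to F_1\to F_0$, with an augmentation $F_0\to R$, is given by $F_i=\bigoplus_{j=1}^{r_i}R(-\mu_{i,j})$ and maps of multidegree $0$; thus the entries of the matrices of these maps have the form $c\,\mathbf x^{\nu-\mu}$, where $c\in\mathbf k$, $\nu$ and $\mu$ are the multidegrees of the basis elements of the source and of the target, and $c=0$ unless $\mu\le\nu$. If all $\mu_{i,j}\le a$,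 its polarization $\overline{\mathbb F}$ has $\overline F_i=\bigoplus_{j=1}^{r_i}S(-\overline{\mu_{i,j}})$, and each entry $c\,\mathbf x^{\nu-\mu}$ is replaced by $c\,\mathbf x^{\overline\nu-\overline\mu}$. The complex $\mathbb F$ is a free resolution of $I$ if $\cdots\to F_1\to F_0\to I\to 0$ is exact. Iterated mapping cones of nonzero monomial ideals $J$ are defined recursively. If $J=\langle m\rangle$ is principal, take $0\to R(-m)\to\langle m\rangle\to 0$. Otherwise choose any $m\in G(J)$ (the pivot), put $J'=\langle G(J)\setminus\{m\}\rangle$ and $\widetilde J=J'\cap\langle m\rangle$, choose iterated mapping cones $\mathbb L$ of $\widetilde J$ and $\mathbb F'$ of $J'$, and take the mapping cone of a multigraded chain map $\mathbb L\to\mathbb F'\oplus R(-m)$ that lifts the map $(\iota',-\iota''):\widetilde J\to J'\oplus\langle m\rangle$, where $\iota'$ and $\iota''$ are the inclusions. Any complex isomorphic (as an augmented multigraded complex) to an iterated mapping cone of $J$ is also called one. A cone resolution of $J$ is a multigraded free resolution of $J$ that is an iterated mapping cone of $J$. A Mayer–Vietoris tree of a nonzero monomial ideal $J$ is a binary tree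 with nodes labeled by ideals, defined recursively: its root is $J$; if $J$ is principal, the root is a leaf; otherwise there is a pivot $m\in G(J)$ such that, with $J'$ and $\widetilde J$ as above, the left subtree is a Mayer–Vietoris tree of $\widetilde J$ and the right subtree is one of $J'$. The polarized tree $\overline{\mathbb T}$ of a Mayer–Vietoris tree $\mathbb T$ of $I$ is obtained by replacing every label $K$ by $\overline K$ (with respect to the vector $a$ of $I$). The same definitions are used over $S$. **Corollary.** If $\mathbb F$ is a cone resolution of $I$, then $\overline{\mathbb F}$ is a cone resolution of $I^P$. Moreover, if $\mathbb T$ is a Mayer–Vietoris tree of $I$, then $\overline{\mathbb T}$ is a Mayer–Vietoris tree of $I^P$. -/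

import Mathlib

namespace MonPol

open MvPolynomial

/-! ### Monomial ideals -/

section Ideals

variable {k : Type*} [Field k] {σ : Type*}

/-- The ideal generated by the monomials `x^s`, `s ∈ S`. -/
noncomputable def monomialIdeal (k : Type*) [Field k] {σ : Type*} (S : Set (σ →₀ ℕ)) :
    Ideal (MvPolynomial σ k) :=
  Ideal.span ((fun s => monomial s (1 : k)) '' S)

/-- An ideal of a polynomial ring is monomial if it is generated by monomials. -/
def IsMonomialIdeal (I : Ideal (MvPolynomial σ k)) : Prop :=
  ∃ S : Set (σ →₀ ℕ), I = monomialIdeal k S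

/-- The exponents of the monomials in `I` that are minimal for divisibility. For a monomial ideal
these are the exponents of its unique minimal monomial generating set `G(I)`. -/
def minGens (I : Ideal (MvPolynomial σ k)) : Set (σ →₀ ℕ) :=
  {s | Minimal (fun t => monomial t (1 : k) ∈ I) s}

theorem minGens_finite [Finite σ] (I : Ideal (MvPolynomial σ k)) : (minGens I).Finite := by
  have h : IsAntichain (· ≤ ·) (minGens I) := by
    intro s hs t ht hst hle
    exact hst (le_antisymm hle (ht.2 hs.1 hle))
  exact WellQuasiOrderedLE.finite_of_isAntichain h

/-- The largest exponent with which each variable occurs in a minimal generator of `I`. -/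
noncomputable def maxExp [Finite σ] (I : Ideal (MvPolynomial σ k)) (i : σ) : ℕ :=
  (minGens_finite I).toFinset.sup (fun s => s i)

end Ideals

/-! ### Polarization of exponents and ideals -/

section Polarization

variable {k : Type*} [Field k] {n : ℕ}

/-- The variables `x_{i,1}, …, x_{i,a_i}` of the polarized ring (the second index starts at `0`
here). -/
abbrev PolVar {n : ℕ} (a : Fin n → ℕ) : Type := Σ i : Fin n, Fin (a i)

/-- The polarization of an exponent `b` with respect to `a`: for each `i`, the first `b i` of the
`a i` variables over `i` get exponent `1`, the others `0`. It is meant for `b ≤ a`. -/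
noncomputable def pol (a : Fin n → ℕ) (b : Fin n →₀ ℕ) : PolVar a →₀ ℕ :=
  Finsupp.equivFunOnFinite.symm (fun v => if (v.2 : ℕ) < b v.1 then 1 else 0)

theorem pol_zero (a : Fin n → ℕ) : pol a 0 = 0 := by
  ext v
  simp [pol]

theorem pol_mono (a : Fin n → ℕ) {b c : Fin n →₀ ℕ} (h : b ≤ c) : pol a b ≤ pol a c := by
  intro v
  have hv := h v.1
  simp only [pol, Finsupp.equivFunOnFinite_symm_apply_apply]
  split_ifs <;> omega

/-- The ideal generated by the polarizations, with respect to `a`, of the minimal generators. -/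
noncomputable def polarizeIdeal (a : Fin n → ℕ) (J : Ideal (MvPolynomial (Fin n) k)) :
    Ideal (MvPolynomial (PolVar a) k) :=
  monomialIdeal k (pol a '' minGens J)

/-- The polarization `I^P`. -/
noncomputable def polarization (I : Ideal (MvPolynomial (Fin n) k)) :
    Ideal (MvPolynomial (PolVar (maxExp I)) k) :=
  polarizeIdeal (maxExp I) I

end Polarization

/-! ### Multigraded complexes -/

section Complexes

variable {k : Type*} [Field k] {σ τ : Type*}

/-- The polynomials `f` for which `1 ↦ f` is a map `R(-ν) → R(-μ)` of multidegree `0`: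
the scalar multiples of `x^(ν - μ)` if `x^μ` divides `x^ν`, and only `0` otherwise. -/
def IsHomEntry (μ ν : σ →₀ ℕ) (f : MvPolynomial σ k) : Prop :=
  f = 0 ∨ μ ≤ ν ∧ ∃ c : k, f = monomial (ν - μ) c

theorem IsHomEntry.neg {μ ν : σ →₀ ℕ} {f : MvPolynomial σ k} (h : IsHomEntry μ ν f) :
    IsHomEntry μ ν (-f) := by
  rcases h with h | ⟨h, c, rfl⟩
  · left; simp [h]
  · exact Or.inr ⟨h, -c, by simp⟩

theorem IsHomEntry.mul {μ ν ρ : σ →₀ ℕ} {f g : MvPolynomial σ k} (hf : IsHomEntry μ ν f)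
    (hg : IsHomEntry ν ρ g) :
    f * g = monomial (ρ - μ) (coeff (ν - μ) f * coeff (ρ - ν) g) := by
  rcases hf with rfl | ⟨h1, c, rfl⟩
  · simp
  rcases hg with rfl | ⟨h2, d, rfl⟩
  · simp
  rw [monomial_mul]
  have : ν - μ + (ρ - ν) = ρ - μ := by
    rw [add_comm]; exact tsub_add_tsub_cancel h2 h1
  classical
  rw [this, coeff_monomial, coeff_monomial, if_pos rfl, if_pos rfl]

/-- A multigraded complex `⋯ → F₁ → F₀` of finitely generated free modules over
`R = k[x_s : s ∈ σ]`, with chosen homogeneous bases and with an augmentation `F₀ → R`: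
`F_i = ⨁_{p ∈ ι i} R(-deg i p)`, the matrix of the differential `F_{i+1} → F_i` is `d i` (its
`q`-th column is the image of the basis element `q`), and `aug p` is the image in `R` of the basis
element `p` of `F₀`. All maps have multidegree `0`. -/
structure MGComplex (k : Type*) [Field k] (σ : Type*) where
  ι : ℕ → Type
  fin : ∀ i, Fintype (ι i)
  deg : ∀ i, ι i → σ →₀ ℕ
  d : ∀ i, Matrix (ι i) (ι (i + 1)) (MvPolynomial σ k)
  aug : ι 0 → MvPolynomial σ k
  d_hom : ∀ i p q, IsHomEntry (deg i p) (deg (i + 1) q) (d i p q)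
  aug_hom : ∀ p, IsHomEntry 0 (deg 0 p) (aug p)
  d_comp_d : ∀ i, d i * d (i + 1) = 0
  aug_comp_d : Matrix.vecMul aug (d 0) = 0

attribute [instance] MGComplex.fin

/-- A morphism of augmented multigraded complexes: a chain map of multidegree `0`, given by
matrices, that is compatible with the augmentations. If `F` and `G` resolve ideals `J ⊆ J'`, these
are the multigraded chain maps lifting the inclusion of `J` in `J'`. -/
structure MGHom (F G : MGComplex k σ) where
  f : ∀ i, Matrix (G.ι i) (F.ι i) (MvPolynomial σ k)
  f_hom : ∀ i p q, IsHomEntry (G.deg i p) (F.deg i q) (f i p q)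
  comm : ∀ i, f i * F.d i = G.d i * f (i + 1)
  aug_comm : Matrix.vecMul G.aug (f 0) = F.aug

open Classical in
/-- Isomorphism of augmented multigraded complexes. -/
def MGIso (F G : MGComplex k σ) : Prop :=
  ∃ (u : MGHom F G) (v : MGHom G F), ∀ i, u.f i * v.f i = 1 ∧ v.f i * u.f i = 1

/-- `F` is a multigraded free resolution of the ideal `I`: the sequence
`⋯ → F₁ → F₀ → I → 0` is exact. -/
def IsFreeResolution (I : Ideal (MvPolynomial σ k)) (F : MGComplex k σ) : Prop :=
  LinearMap.range (Fintype.linearCombination (MvPolynomial σ k) F.aug) = I ∧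
  Function.Exact (F.d 0).mulVecLin (Fintype.linearCombination (MvPolynomial σ k) F.aug) ∧
  ∀ i, Function.Exact (F.d (i + 1)).mulVecLin (F.d i).mulVecLin

/-- The index sets of a complex of rank one in homological degree `0` and zero elsewhere. -/
def principalι : ℕ → Type
  | 0 => Unit
  | _ + 1 => Empty

instance principalFin : ∀ i, Fintype (principalι i)
  | 0 => inferInstanceAs (Fintype Unit)
  | _ + 1 => inferInstanceAs (Fintype Empty)

/-- The resolution `0 → R(-m) → ⟨x^m⟩ → 0` of a principal monomial ideal. -/
noncomputable def principal (k : Type*) [Field k] {σ : Type*} (m : σ →₀ ℕ) : MGComplex k σ where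
  ι := principalι
  fin := principalFin
  deg _ _ := m
  d _ := 0
  aug _ := monomial m 1
  d_hom _ _ _ := Or.inl rfl
  aug_hom _ := Or.inr ⟨zero_le, 1, by simp⟩
  d_comp_d _ := Matrix.zero_mul _
  aug_comp_d := Matrix.vecMul_zero _

/-! ### Mapping cones -/

/-- The index sets of the complex `F[-1]`, i.e. `F` moved up by one homological degree. -/
def shiftι (F : MGComplex k σ) : ℕ → Type
  | 0 => Empty
  | i + 1 => F.ι i

instance shiftFin (F : MGComplex k σ) : ∀ i, Fintype (shiftι F i)
  | 0 => inferInstanceAs (Fintype Empty)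
  | i + 1 => F.fin i

/-- The multidegrees of the basis of `F[-1]`. -/
def shiftDeg (F : MGComplex k σ) : ∀ i, shiftι F i → σ →₀ ℕ
  | 0 => fun e => Empty.elim e
  | i + 1 => F.deg i

/-- The matrices of the differentials (without sign) of `F[-1]`. -/
def shiftD (F : MGComplex k σ) :
    ∀ i, Matrix (shiftι F i) (shiftι F (i + 1)) (MvPolynomial σ k)
  | 0 => fun e _ => Empty.elim e
  | i + 1 => F.d i

/-- The differentials of the mapping cone of `(u, -v) : L → F ⊕ G`, that is
`(x, y, z) ↦ (d x + u z, d y - v z, - d z)`. -/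
noncomputable def coneD {L F G : MGComplex k σ} (u : MGHom L F) (v : MGHom L G) (i : ℕ) :
    Matrix ((F.ι i ⊕ G.ι i) ⊕ shiftι L i)
      ((F.ι (i + 1) ⊕ G.ι (i + 1)) ⊕ shiftι L (i + 1)) (MvPolynomial σ k) :=
  Matrix.fromBlocks (Matrix.fromBlocks (F.d i) 0 0 (G.d i))
    (Matrix.fromRows (u.f i) (-(v.f i))) 0 (-(shiftD L i))

/-- The augmentation of the mapping cone of `(u, -v) : L → F ⊕ G`, that is the sum of the
augmentations of `F` and `G`. -/
noncomputable def coneAug (L F G : MGComplex k σ) : (F.ι 0 ⊕ G.ι 0) ⊕ shiftι L 0 → MvPolynomial σ k :=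
  Sum.elim (Sum.elim F.aug G.aug) (fun e => Empty.elim e)

theorem coneD_hom {L F G : MGComplex k σ} (u : MGHom L F) (v : MGHom L G) (i : ℕ)
    (p : (F.ι i ⊕ G.ι i) ⊕ shiftι L i)
    (q : (F.ι (i + 1) ⊕ G.ι (i + 1)) ⊕ shiftι L (i + 1)) :
    IsHomEntry (Sum.elim (Sum.elim (F.deg i) (G.deg i)) (shiftDeg L i) p)
      (Sum.elim (Sum.elim (F.deg (i + 1)) (G.deg (i + 1))) (shiftDeg L (i + 1)) q)
      (coneD u v i p q) := by
  rcases p with (p | p) | p <;> rcases q with (q | q) | q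
  · exact F.d_hom i p q
  · exact Or.inl rfl
  · exact u.f_hom i p q
  · exact Or.inl rfl
  · exact G.d_hom i p q
  · exact (v.f_hom i p q).neg
  · exact Or.inl rfl
  · exact Or.inl rfl
  · cases i with
    | zero => exact Empty.elim p
    | succ i => exact (L.d_hom i p q).neg

theorem shiftD_comp (L : MGComplex k σ) (i : ℕ) : shiftD L i * shiftD L (i + 1) = 0 := by
  cases i with
  | zero => ext e; exact Empty.elim e
  | succ i => exact L.d_comp_d i

theorem block_comp {R : Type*} [CommRing R] {f₀ f₁ f₂ g₀ g₁ g₂ l₀ l₁ l₂ : Type*} [Fintype f₁]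
    [Fintype g₁] [Fintype l₁] (A : Matrix f₀ f₁ R) (A' : Matrix f₁ f₂ R) (B : Matrix g₀ g₁ R)
    (B' : Matrix g₁ g₂ R) (C : Matrix l₀ l₁ R) (C' : Matrix l₁ l₂ R) (U : Matrix f₀ l₁ R)
    (U' : Matrix f₁ l₂ R) (V : Matrix g₀ l₁ R) (V' : Matrix g₁ l₂ R) (hA : A * A' = 0)
    (hB : B * B' = 0) (hC : C * C' = 0) (hU : U * C' = A * U') (hV : V * C' = B * V') :
    Matrix.fromBlocks (Matrix.fromBlocks A 0 0 B) (Matrix.fromRows U (-V)) 0 (-C) *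
      Matrix.fromBlocks (Matrix.fromBlocks A' 0 0 B') (Matrix.fromRows U' (-V')) 0 (-C') = 0 := by
  have h1 : Matrix.fromBlocks A 0 0 B * Matrix.fromRows U' (-V') +
      Matrix.fromRows U (-V) * (-C') = 0 := by
    rw [Matrix.fromBlocks_mul_fromRows, Matrix.fromRows_mul]
    ext p q
    rcases p with p | p
    · simp [hU]
    · simp [hV]
  have h2 : Matrix.fromBlocks A 0 0 B * Matrix.fromBlocks A' 0 0 B' = 0 := by
    simp [Matrix.fromBlocks_multiply, hA, hB]
  rw [Matrix.fromBlocks_multiply, h1, h2]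
  simp [hC]

theorem coneD_comp {L F G : MGComplex k σ} (u : MGHom L F) (v : MGHom L G) (i : ℕ) :
    coneD u v i * coneD u v (i + 1) = 0 :=
  block_comp _ _ _ _ _ _ _ _ _ _ (F.d_comp_d i) (G.d_comp_d i) (shiftD_comp L i) (u.comm i)
    (v.comm i)

theorem coneAug_comp {L F G : MGComplex k σ} (u : MGHom L F) (v : MGHom L G) :
    Matrix.vecMul (coneAug L F G) (coneD u v 0) = 0 := by
  ext1 q
  rcases q with (q | q) | q
  · have := congrFun F.aug_comp_d q
    simpa [Matrix.vecMul, dotProduct, coneAug, coneD, Fintype.sum_sum_type] using this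
  · have := congrFun G.aug_comp_d q
    simpa [Matrix.vecMul, dotProduct, coneAug, coneD, Fintype.sum_sum_type] using this
  · have hu := congrFun u.aug_comm q
    have hv := congrFun v.aug_comm q
    have : IsEmpty (shiftι L 0) := ⟨fun x => Empty.elim x⟩
    have h : ∑ x, F.aug x * u.f 0 x q + ∑ x, G.aug x * (-(v.f 0 x q)) = 0 := by
      simp only [Matrix.vecMul, dotProduct] at hu hv
      simp only [mul_neg, Finset.sum_neg_distrib]
      rw [hu, hv, add_neg_cancel]
    simp only [Matrix.vecMul, dotProduct, coneAug, coneD, Fintype.sum_sum_type, Sum.elim_inl,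
      Sum.elim_inr, Finset.univ_eq_empty, Finset.sum_empty, add_zero]
    exact h

/-- The mapping cone of `(u, -v) : L → F ⊕ G`; its module in homological degree `i` is
`F_i ⊕ G_i ⊕ L_{i-1}`. -/
noncomputable def cone {L F G : MGComplex k σ} (u : MGHom L F) (v : MGHom L G) : MGComplex k σ where
  ι i := (F.ι i ⊕ G.ι i) ⊕ shiftι L i
  fin i := inferInstance
  deg i := Sum.elim (Sum.elim (F.deg i) (G.deg i)) (shiftDeg L i)
  d i := coneD u v i
  aug := coneAug L F G
  d_hom i p q := coneD_hom u v i p q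
  aug_hom p := by
    rcases p with (p | p) | p
    · exact F.aug_hom p
    · exact G.aug_hom p
    · exact Empty.elim p
  d_comp_d i := coneD_comp u v i
  aug_comp_d := coneAug_comp u v

/-- The complexes obtained for a nonzero monomial ideal `I` by iterated mapping cones. If `I` is
principal, take `0 → R(-m)`. Otherwise select a minimal generator `x^m` of `I` (the pivot), let
`I'` be the ideal generated by the other minimal generators, and take the mapping cone of a lift
`L → F ⊕ R(-m)` of `I' ∩ ⟨x^m⟩ → I' ⊕ ⟨x^m⟩`, where `L` and `F` are iterated mapping cones for
`I' ∩ ⟨x^m⟩` and `I'`; this comes from the short exact sequence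
`0 → I' ∩ ⟨x^m⟩ → I' ⊕ ⟨x^m⟩ → I → 0`. Complexes are considered up to multigraded isomorphism. -/
inductive IsIteratedCone : Ideal (MvPolynomial σ k) → MGComplex k σ → Prop
  | single (m : σ →₀ ℕ) : IsIteratedCone (monomialIdeal k {m}) (principal k m)
  | step (I : Ideal (MvPolynomial σ k)) (hI : IsMonomialIdeal I) (m : σ →₀ ℕ)
      (hm : m ∈ minGens I) (hne : (minGens I \ {m}).Nonempty) (L F : MGComplex k σ)
      (hL : IsIteratedCone (monomialIdeal k (minGens I \ {m}) ⊓ monomialIdeal k {m}) L)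
      (hF : IsIteratedCone (monomialIdeal k (minGens I \ {m})) F)
      (u : MGHom L F) (v : MGHom L (principal k m)) : IsIteratedCone I (cone u v)
  | of_iso (I : Ideal (MvPolynomial σ k)) (F G : MGComplex k σ) (hF : IsIteratedCone I F)
      (h : MGIso F G) : IsIteratedCone I G

/-- `F` is a (mapping) cone resolution of the monomial ideal `I`: a multigraded free resolution of
`I` that arises by iterated mapping cones. -/
def IsConeResolution (I : Ideal (MvPolynomial σ k)) (F : MGComplex k σ) : Prop :=
  IsFreeResolution I F ∧ IsIteratedCone I F

end Complexes

/-! ### Polarization of multigraded complexes -/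

section PolarizeComplex

variable {k : Type*} [Field k] {n : ℕ}

/-- The polarization of the entry `f` of a map `R(-ν) → R(-μ)`: the monomial `x^(ν - μ)` is
replaced by `x^(ν̄ - μ̄)`, the scalar coefficient is kept. -/
noncomputable def polEntry (a : Fin n → ℕ) (μ ν : Fin n →₀ ℕ) (f : MvPolynomial (Fin n) k) :
    MvPolynomial (PolVar a) k :=
  monomial (pol a ν - pol a μ) (coeff (ν - μ) f)

theorem polEntry_hom (a : Fin n → ℕ) {μ ν : Fin n →₀ ℕ} {f : MvPolynomial (Fin n) k}
    (h : IsHomEntry μ ν f) : IsHomEntry (pol a μ) (pol a ν) (polEntry a μ ν f) := by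
  rcases h with rfl | ⟨h, -⟩
  · left; simp [polEntry]
  · exact Or.inr ⟨pol_mono a h, _, rfl⟩

theorem polEntry_sum (a : Fin n → ℕ) {α : Type*} [Fintype α] {μ ρ : Fin n →₀ ℕ}
    (ν : α → Fin n →₀ ℕ) (f g : α → MvPolynomial (Fin n) k)
    (hf : ∀ x, IsHomEntry μ (ν x) (f x)) (hg : ∀ x, IsHomEntry (ν x) ρ (g x))
    (h : ∑ x, f x * g x = 0) :
    ∑ x, polEntry a μ (ν x) (f x) * polEntry a (ν x) ρ (g x) = 0 := by
  have h1 : ∑ x, coeff (ν x - μ) (f x) * coeff (ρ - ν x) (g x) = 0 := by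
    have h2 : ∑ x, f x * g x
        = monomial (ρ - μ) (∑ x, coeff (ν x - μ) (f x) * coeff (ρ - ν x) (g x)) := by
      rw [map_sum]
      exact Finset.sum_congr rfl fun x _ => (hf x).mul (hg x)
    rw [h2, monomial_eq_zero] at h
    exact h
  calc _ = ∑ x, monomial (pol a ρ - pol a μ)
        (coeff (ν x - μ) (f x) * coeff (ρ - ν x) (g x)) := by
        refine Finset.sum_congr rfl fun x _ => ?_
        rw [(polEntry_hom a (hf x)).mul (polEntry_hom a (hg x))]
        simp [polEntry]
    _ = 0 := by rw [← map_sum, h1, map_zero]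

/-- The polarization of a multigraded complex with respect to `a`. It is meant for complexes all of
whose multidegrees are at most `a`. -/
noncomputable def MGComplex.polarize (a : Fin n → ℕ) (F : MGComplex k (Fin n)) :
    MGComplex k (PolVar a) where
  ι := F.ι
  fin := F.fin
  deg i p := pol a (F.deg i p)
  d i := fun p q => polEntry a (F.deg i p) (F.deg (i + 1) q) (F.d i p q)
  aug p := polEntry a 0 (F.deg 0 p) (F.aug p)
  d_hom i p q := polEntry_hom a (F.d_hom i p q)
  aug_hom p := by
    have h := polEntry_hom a (F.aug_hom p)
    rwa [pol_zero] at h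
  d_comp_d i := by
    ext1 p r
    exact polEntry_sum a (fun q => F.deg (i + 1) q) (fun q => F.d i p q)
      (fun q => F.d (i + 1) q r) (fun q => F.d_hom i p q) (fun q => F.d_hom (i + 1) q r)
      (congrFun (congrFun (F.d_comp_d i) p) r)
  aug_comp_d := by
    ext1 q
    exact polEntry_sum a (fun p => F.deg 0 p) F.aug (fun p => F.d 0 p q) F.aug_hom
      (fun p => F.d_hom 0 p q) (congrFun F.aug_comp_d q)

end PolarizeComplex

/-! ### Mayer-Vietoris trees -/

/-- Finite binary trees with a label at each node; every node has either no child or both a left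
and a right child. -/
inductive LabeledTree (α : Type*) where
  | leaf (J : α) : LabeledTree α
  | node (J : α) (left right : LabeledTree α) : LabeledTree α

/-- Apply a function to all labels. -/
def LabeledTree.map {α β : Type*} (φ : α → β) : LabeledTree α → LabeledTree β
  | .leaf J => .leaf (φ J)
  | .node J l r => .node (φ J) (l.map φ) (r.map φ)

section Trees

variable {k : Type*} [Field k] {σ : Type*}

/-- `T` is a Mayer-Vietoris tree of the monomial ideal `I`: the root is labeled by `I`; a node is
a leaf exactly if its ideal is principal; otherwise a minimal generator `x^m` of the ideal of the
node is selected (the pivot), the right child is the ideal `I'` generated by the other minimal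
generators, and the left child is `I' ∩ ⟨x^m⟩`. The pivots may be selected arbitrarily. -/
def IsMayerVietorisTree :
    Ideal (MvPolynomial σ k) → LabeledTree (Ideal (MvPolynomial σ k)) → Prop
  | I, .leaf J => J = I ∧ ∃ m, I = monomialIdeal k {m}
  | I, .node J l r => J = I ∧ IsMonomialIdeal I ∧
      ∃ m ∈ minGens I, (minGens I \ {m}).Nonempty ∧
        IsMayerVietorisTree (monomialIdeal k (minGens I \ {m}) ⊓ monomialIdeal k {m}) l ∧
        IsMayerVietorisTree (monomialIdeal k (minGens I \ {m})) r

end Trees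

end MonPol

/-! On exponents bounded by `a`, the map `pol a` is an order embedding that carries lcms to lcms
(`pol_sup`, `le_of_pol_le`). It therefore identifies the minimal generators of a bounded monomial
ideal with those of its polarization, and polarizing ideals commutes with both operations at a
pivot: deleting it from the generators (`minGens_polarizeIdeal_diff`) and intersecting with the
ideal it generates (`polarizeIdeal_inf_singleton`). Induction on the tree gives the claim for
Mayer–Vietoris trees.

For complexes, polarization keeps scalar coefficients and alters only the monomials, which the
multidegrees determine. It thus respects matrix products (`polEntry_sum_mul`) and sends chain maps
to chain maps, isomorphisms to isomorphisms and mapping cones to mapping cones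
(`cone_polarize_iso`). The same pivots then exhibit the polarized complex as an iterated cone of the
polarized ideal.

Exactness is not transferred from one ring to the other. A cone over a lift of `J₁ ⊓ J₂ → J₁ ⊕ J₂`
between resolutions resolves `J₁ ⊔ J₂` (`IsFreeResolution.cone`), so over any polynomial ring every
iterated cone is a resolution (`IsIteratedCone.isFreeResolution`). This is applied over the
polarized ring. -/

namespace MonPol

open MvPolynomial

/-! ### Monomial ideals and their minimal generators -/

section Ideals

variable {k : Type*} [Field k] {σ : Type*}

theorem monomial_mem_monomialIdeal {S : Set (σ →₀ ℕ)} {t : σ →₀ ℕ} :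
    monomial t (1 : k) ∈ monomialIdeal k S ↔ ∃ s ∈ S, s ≤ t := by
  classical
  rw [monomialIdeal, mem_ideal_span_monomial_image]
  simp [support_monomial]

theorem mem_monomialIdeal {S : Set (σ →₀ ℕ)} {f : MvPolynomial σ k} :
    f ∈ monomialIdeal k S ↔ ∀ t ∈ f.support, ∃ s ∈ S, s ≤ t :=
  mem_ideal_span_monomial_image

theorem minGens_monomialIdeal (S : Set (σ →₀ ℕ)) :
    minGens (monomialIdeal k S) = {s | Minimal (· ∈ S) s} := by
  ext t
  simp only [minGens, monomial_mem_monomialIdeal, Set.mem_ofPred_eq]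
  constructor
  · rintro ⟨⟨s, hs, hst⟩, hmin⟩
    have : t = s := le_antisymm (hmin ⟨s, hs, le_rfl⟩ hst) hst
    subst this
    exact ⟨hs, fun r hr hrt => hmin ⟨r, hr, le_rfl⟩ hrt⟩
  · rintro ⟨ht, hmin⟩
    exact ⟨⟨t, ht, le_rfl⟩, fun r ⟨s, hs, hsr⟩ hrt => (hmin hs (hsr.trans hrt)).trans hsr⟩

theorem minGens_monomialIdeal_subset (S : Set (σ →₀ ℕ)) :
    minGens (monomialIdeal k S) ⊆ S := by
  rw [minGens_monomialIdeal]
  exact fun s hs => hs.1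

theorem minGens_isAntichain (I : Ideal (MvPolynomial σ k)) :
    IsAntichain (· ≤ ·) (minGens I) :=
  fun _ hs _ ht hst hle => hst (le_antisymm hle (ht.2 hs.1 hle))

theorem minGens_monomialIdeal_of_isAntichain {S : Set (σ →₀ ℕ)} (hS : IsAntichain (· ≤ ·) S) :
    minGens (monomialIdeal k S) = S := by
  refine (minGens_monomialIdeal_subset S).antisymm fun s hs => ?_
  rw [minGens_monomialIdeal]
  exact ⟨hs, fun t ht hts => (hS.eq ht hs hts).ge⟩

theorem exists_minimal_le {S : Set (σ →₀ ℕ)} {s : σ →₀ ℕ} (hs : s ∈ S) :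
    ∃ t ∈ {t | Minimal (· ∈ S) t}, t ≤ s := by
  obtain ⟨t, hts, ht⟩ := exists_minimal_le_of_wellFoundedLT (· ∈ S) s hs
  exact ⟨t, ht, hts⟩

theorem monomialIdeal_congr {S T : Set (σ →₀ ℕ)} (hST : ∀ s ∈ S, ∃ t ∈ T, t ≤ s)
    (hTS : ∀ t ∈ T, ∃ s ∈ S, s ≤ t) : monomialIdeal k S = monomialIdeal k T := by
  ext f
  simp only [mem_monomialIdeal]
  refine forall₂_congr fun r _ => ⟨?_, ?_⟩
  · rintro ⟨s, hs, hsr⟩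
    obtain ⟨t, ht, hts⟩ := hST s hs
    exact ⟨t, ht, hts.trans hsr⟩
  · rintro ⟨t, ht, htr⟩
    obtain ⟨s, hs, hst⟩ := hTS t ht
    exact ⟨s, hs, hst.trans htr⟩

theorem IsMonomialIdeal.eq_monomialIdeal_minGens {I : Ideal (MvPolynomial σ k)}
    (hI : IsMonomialIdeal I) : I = monomialIdeal k (minGens I) := by
  obtain ⟨S, rfl⟩ := hI
  rw [minGens_monomialIdeal]
  exact monomialIdeal_congr (fun s hs => exists_minimal_le hs) fun t ht => ⟨t, ht.1, le_rfl⟩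

theorem monomialIdeal_union (S T : Set (σ →₀ ℕ)) :
    monomialIdeal k (S ∪ T) = monomialIdeal k S ⊔ monomialIdeal k T := by
  rw [monomialIdeal, Set.image_union, Ideal.span_union]
  rfl

/-- Puts the ideal at a pivot step into the form `J₁ ⊔ J₂` resolved by a mapping cone. -/
theorem IsMonomialIdeal.eq_sup_pivot {I : Ideal (MvPolynomial σ k)} (hI : IsMonomialIdeal I)
    {m : σ →₀ ℕ} (hm : m ∈ minGens I) :
    I = monomialIdeal k (minGens I \ {m}) ⊔ monomialIdeal k {m} := by
  rw [← monomialIdeal_union, Set.sdiff_union_of_subset (Set.singleton_subset_iff.mpr hm)]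
  exact hI.eq_monomialIdeal_minGens

/-- A monomial is divisible by both `x^s` and `x^m` exactly if their lcm divides it. The lcms need
not form an antichain, so later statements allow arbitrary generating sets. -/
theorem monomialIdeal_inf_singleton (S : Set (σ →₀ ℕ)) (m : σ →₀ ℕ) :
    monomialIdeal k S ⊓ monomialIdeal k {m} = monomialIdeal k ((· ⊔ m) '' S) := by
  ext f
  simp only [Submodule.mem_inf, mem_monomialIdeal, Set.mem_singleton_iff, exists_eq_left,
    Set.exists_mem_image, sup_le_iff]
  refine ⟨fun h t ht => ?_, fun h => ⟨fun t ht => ?_, fun t ht => ?_⟩⟩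
  · obtain ⟨s, hs, hst⟩ := h.1 t ht
    exact ⟨s, hs, hst, h.2 t ht⟩
  · obtain ⟨s, hs, hst, -⟩ := h t ht
    exact ⟨s, hs, hst⟩
  · obtain ⟨s, -, -, hmt⟩ := h t ht
    exact hmt

end Ideals

/-! ### Polarization of exponents, ideals and Mayer–Vietoris trees -/

section Polarization

variable {k : Type*} [Field k] {n : ℕ}

theorem pol_apply (a : Fin n → ℕ) (b : Fin n →₀ ℕ) (v : PolVar a) :
    pol a b v = if (v.2 : ℕ) < b v.1 then 1 else 0 := rfl

theorem pol_sup (a : Fin n → ℕ) (b c : Fin n →₀ ℕ) : pol a (b ⊔ c) = pol a b ⊔ pol a c := by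
  ext v
  simp only [pol_apply, Finsupp.sup_apply]
  by_cases hb : (v.2 : ℕ) < b v.1 <;> by_cases hc : (v.2 : ℕ) < c v.1 <;> simp [hb, hc]

theorem le_of_pol_le (a : Fin n → ℕ) {b c : Fin n →₀ ℕ} (hb : ∀ i, b i ≤ a i)
    (h : pol a b ≤ pol a c) : b ≤ c := by
  intro i
  by_contra hlt
  have hi : c i < b i := not_le.mp hlt
  -- Second indices start at `0`, so the variable with index `c i` over `i` is the first one absent
  -- from `pol a c`. It occurs in `pol a b`, and it exists because `c i < b i ≤ a i`.
  have := h ⟨i, ⟨c i, hi.trans_le (hb i)⟩⟩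
  simp [pol_apply, hi] at this

theorem pol_injOn (a : Fin n → ℕ) : Set.InjOn (pol a) {b | ∀ i, b i ≤ a i} :=
  fun _ hb _ hc h => le_antisymm (le_of_pol_le a hb h.le) (le_of_pol_le a hc h.ge)

/-- Redundant generators stay redundant because `pol a` is monotone, so no minimality or bound on
`S` is needed. -/
theorem polarizeIdeal_monomialIdeal (a : Fin n → ℕ) (S : Set (Fin n →₀ ℕ)) :
    polarizeIdeal a (monomialIdeal k S) = monomialIdeal k (pol a '' S) := by
  rw [polarizeIdeal, minGens_monomialIdeal]
  refine monomialIdeal_congr ?_ ?_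
  · rintro _ ⟨s, hs, rfl⟩
    exact ⟨_, ⟨s, hs.1, rfl⟩, le_rfl⟩
  · rintro _ ⟨s, hs, rfl⟩
    obtain ⟨t, ht, hts⟩ := exists_minimal_le hs
    exact ⟨_, ⟨t, ht, rfl⟩, pol_mono a hts⟩

theorem polarizeIdeal_singleton (a : Fin n → ℕ) (m : Fin n →₀ ℕ) :
    polarizeIdeal a (monomialIdeal k {m}) = monomialIdeal k {pol a m} := by
  rw [polarizeIdeal_monomialIdeal, Set.image_singleton]

theorem polarizeIdeal_inf_singleton (a : Fin n → ℕ) (S : Set (Fin n →₀ ℕ)) (m : Fin n →₀ ℕ) :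
    polarizeIdeal a (monomialIdeal k S ⊓ monomialIdeal k {m}) =
      monomialIdeal k (pol a '' S) ⊓ monomialIdeal k {pol a m} := by
  rw [monomialIdeal_inf_singleton, polarizeIdeal_monomialIdeal, monomialIdeal_inf_singleton,
    Set.image_image, Set.image_image]
  simp only [pol_sup]

/-- Since `pol a` reflects divisibility below `a`, an antichain of bounded exponents remains an
antichain. -/
theorem minGens_polarizeIdeal (a : Fin n → ℕ) {I : Ideal (MvPolynomial (Fin n) k)}
    (ha : ∀ s ∈ minGens I, ∀ i, s i ≤ a i) :
    minGens (polarizeIdeal a I) = pol a '' minGens I := by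
  refine minGens_monomialIdeal_of_isAntichain ?_
  rintro _ ⟨s, hs, rfl⟩ _ ⟨t, ht, rfl⟩ hne hle
  exact hne (congrArg _ ((minGens_isAntichain I).eq hs ht (le_of_pol_le a (ha s hs) hle)))

theorem minGens_polarizeIdeal_diff (a : Fin n → ℕ) {I : Ideal (MvPolynomial (Fin n) k)}
    (ha : ∀ s ∈ minGens I, ∀ i, s i ≤ a i) {m : Fin n →₀ ℕ} (hm : m ∈ minGens I) :
    minGens (polarizeIdeal a I) \ {pol a m} = pol a '' (minGens I \ {m}) := by
  rw [minGens_polarizeIdeal a ha, ← Set.image_singleton, ((pol_injOn a).mono ha).image_sdiff_subset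
    (Set.singleton_subset_iff.mpr hm)]

theorem le_of_mem_minGens_monomialIdeal_diff {a : Fin n → ℕ} {I : Ideal (MvPolynomial (Fin n) k)}
    (ha : ∀ s ∈ minGens I, ∀ i, s i ≤ a i) (m : Fin n →₀ ℕ) :
    ∀ s ∈ minGens (monomialIdeal k (minGens I \ {m})), ∀ i, s i ≤ a i :=
  fun s hs => ha s (minGens_monomialIdeal_subset _ hs).1

/-- The lcm of two exponents bounded by `a` is bounded by `a`, so the bound passes to the left
child. -/
theorem le_of_mem_minGens_monomialIdeal_diff_inf {a : Fin n → ℕ}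
    {I : Ideal (MvPolynomial (Fin n) k)} (ha : ∀ s ∈ minGens I, ∀ i, s i ≤ a i)
    {m : Fin n →₀ ℕ} (hm : m ∈ minGens I) :
    ∀ s ∈ minGens (monomialIdeal k (minGens I \ {m}) ⊓ monomialIdeal k {m}),
      ∀ i, s i ≤ a i := by
  intro s hs i
  rw [monomialIdeal_inf_singleton] at hs
  obtain ⟨t, ht, rfl⟩ := minGens_monomialIdeal_subset _ hs
  exact max_le (ha t ht.1 i) (ha m hm i)

theorem le_maxExp {I : Ideal (MvPolynomial (Fin n) k)} :
    ∀ s ∈ minGens I, ∀ i, s i ≤ maxExp I i :=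
  fun _ hs i => Finset.le_sup (f := fun s => s i) ((minGens_finite I).mem_toFinset.mpr hs)

/-- The vector `a` is any bound rather than `maxExp I`: the children may have smaller maximal
exponents, while the polarized ring must stay fixed through the induction. -/
theorem IsMayerVietorisTree.map_polarizeIdeal (a : Fin n → ℕ)
    {T : LabeledTree (Ideal (MvPolynomial (Fin n) k))} :
    ∀ {I : Ideal (MvPolynomial (Fin n) k)}, (∀ s ∈ minGens I, ∀ i, s i ≤ a i) →
      IsMayerVietorisTree I T →
      IsMayerVietorisTree (polarizeIdeal a I) (T.map (polarizeIdeal a)) := by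
  induction T with
  | leaf J =>
    rintro I - ⟨rfl, m, rfl⟩
    exact ⟨rfl, pol a m, polarizeIdeal_singleton a m⟩
  | node J l r ihl ihr =>
    rintro I ha ⟨rfl, -, m, hm, hne, hl, hr⟩
    have hl' := ihl (le_of_mem_minGens_monomialIdeal_diff_inf ha hm) hl
    have hr' := ihr (le_of_mem_minGens_monomialIdeal_diff ha m) hr
    rw [polarizeIdeal_inf_singleton, ← minGens_polarizeIdeal_diff a ha hm] at hl'
    rw [polarizeIdeal_monomialIdeal, ← minGens_polarizeIdeal_diff a ha hm] at hr'
    refine ⟨rfl, ⟨_, rfl⟩, pol a m, ?_, ?_, hl', hr'⟩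
    · rw [minGens_polarizeIdeal a ha]
      exact ⟨m, hm, rfl⟩
    · rw [minGens_polarizeIdeal_diff a ha hm]
      exact hne.image _

end Polarization

/-! ### Mapping cones and exactness -/

section Resolutions

variable {k : Type*} [Field k] {σ : Type*}

theorem linearCombination_eq_dotProduct {R α : Type*} [CommRing R] [Fintype α] (w x : α → R) :
    Fintype.linearCombination R w x = dotProduct w x := by
  simp [Fintype.linearCombination_apply, dotProduct, mul_comm]

/-- Exactness in terms of matrices. -/
theorem isFreeResolution_iff (I : Ideal (MvPolynomial σ k)) (F : MGComplex k σ) :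
    IsFreeResolution I F ↔
      (∀ f, f ∈ I ↔ ∃ x, dotProduct F.aug x = f) ∧
      (∀ x, dotProduct F.aug x = 0 → ∃ y, (F.d 0).mulVec y = x) ∧
      ∀ i x, (F.d i).mulVec x = 0 → ∃ y, (F.d (i + 1)).mulVec y = x := by
  have h0 : ∀ y, dotProduct F.aug ((F.d 0).mulVec y) = 0 := fun y => by
    rw [Matrix.dotProduct_mulVec, F.aug_comp_d, zero_dotProduct]
  have h1 : ∀ i y, (F.d i).mulVec ((F.d (i + 1)).mulVec y) = 0 := fun i y => by
    rw [Matrix.mulVec_mulVec, F.d_comp_d, Matrix.zero_mulVec]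
  simp only [IsFreeResolution, Function.Exact, linearCombination_eq_dotProduct, Set.mem_range,
    Matrix.mulVecLin_apply, SetLike.ext_iff, LinearMap.mem_range]
  refine and_congr (forall_congr' fun f => Iff.comm) (and_congr ?_ ?_)
  · refine forall_congr' fun x => ⟨fun h => h.1, fun h => ⟨h, ?_⟩⟩
    rintro ⟨y, rfl⟩
    exact h0 y
  · refine forall_congr' fun i => forall_congr' fun x => ⟨fun h => h.1, fun h => ⟨h, ?_⟩⟩
    rintro ⟨y, rfl⟩
    exact h1 i y

/-- Multiplication by `x^m` is injective because the polynomial ring is a domain. -/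
theorem isFreeResolution_principal (m : σ →₀ ℕ) :
    IsFreeResolution (monomialIdeal k {m}) (principal k m) := by
  rw [isFreeResolution_iff]
  have haug : ∀ x : Unit → MvPolynomial σ k,
      dotProduct (principal k m).aug x = monomial m 1 * x () := fun x =>
    Fintype.sum_unique (fun p : Unit => monomial m (1 : k) * x p)
  refine ⟨fun f => ?_, fun x hx => ⟨0, ?_⟩, fun i x _ => ⟨0, ?_⟩⟩
  · rw [monomialIdeal, Set.image_singleton, Ideal.mem_span_singleton']
    constructor
    · rintro ⟨g, rfl⟩
      exact ⟨fun _ => g, (haug _).trans (mul_comm _ _)⟩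
    · rintro ⟨x, rfl⟩
      exact ⟨x (), (mul_comm _ _).trans (haug x).symm⟩
  · have h : x () = 0 := (mul_eq_zero.mp ((haug x).symm.trans hx)).resolve_left (by simp)
    rw [Matrix.mulVec_zero]
    exact funext fun _ => h.symm
  · exact funext fun p => Empty.elim p

theorem IsFreeResolution.of_iso {I : Ideal (MvPolynomial σ k)} {F G : MGComplex k σ}
    (hF : IsFreeResolution I F) (h : MGIso F G) : IsFreeResolution I G := by
  classical
  rw [isFreeResolution_iff] at hF ⊢
  obtain ⟨h0, h1, h2⟩ := hF
  obtain ⟨u, v, huv⟩ := h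
  have huv' : ∀ i x, (u.f i).mulVec ((v.f i).mulVec x) = x := fun i x => by
    rw [Matrix.mulVec_mulVec, (huv i).1, Matrix.one_mulVec]
  have hua : ∀ x, dotProduct G.aug ((u.f 0).mulVec x) = dotProduct F.aug x := fun x => by
    rw [Matrix.dotProduct_mulVec, u.aug_comm]
  have hva : ∀ x, dotProduct F.aug ((v.f 0).mulVec x) = dotProduct G.aug x := fun x => by
    rw [Matrix.dotProduct_mulVec, v.aug_comm]
  have hud : ∀ i x, (u.f i).mulVec ((F.d i).mulVec x) = (G.d i).mulVec ((u.f (i + 1)).mulVec x) :=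
    fun i x => by rw [Matrix.mulVec_mulVec, Matrix.mulVec_mulVec, u.comm]
  have hvd : ∀ i x, (v.f i).mulVec ((G.d i).mulVec x) = (F.d i).mulVec ((v.f (i + 1)).mulVec x) :=
    fun i x => by rw [Matrix.mulVec_mulVec, Matrix.mulVec_mulVec, v.comm]
  refine ⟨fun f => ?_, fun x hx => ?_, fun i x hx => ?_⟩
  · rw [h0 f]
    constructor
    · rintro ⟨x, rfl⟩
      exact ⟨_, hua x⟩
    · rintro ⟨x, rfl⟩
      exact ⟨_, hva x⟩
  · obtain ⟨y, hy⟩ := h1 ((v.f 0).mulVec x) ((hva x).trans hx)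
    exact ⟨(u.f 1).mulVec y, by rw [← hud, hy, huv']⟩
  · obtain ⟨y, hy⟩ := h2 i ((v.f (i + 1)).mulVec x)
      (by rw [← hvd, hx, Matrix.mulVec_zero])
    exact ⟨(u.f (i + 2)).mulVec y, by rw [← hud, hy, huv']⟩

theorem dotProduct_coneAug {L F G : MGComplex k σ} (x : F.ι 0 → MvPolynomial σ k)
    (y : G.ι 0 → MvPolynomial σ k) (z : shiftι L 0 → MvPolynomial σ k) :
    dotProduct (coneAug L F G) (Sum.elim (Sum.elim x y) z) =
      dotProduct F.aug x + dotProduct G.aug y := by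
  have : IsEmpty (shiftι L 0) := ⟨fun e => Empty.elim e⟩
  rw [coneAug, sumElim_dotProduct_sumElim, sumElim_dotProduct_sumElim]
  simp [dotProduct]

theorem coneD_mulVec {L F G : MGComplex k σ} (u : MGHom L F) (v : MGHom L G) (i : ℕ)
    (x : F.ι (i + 1) → MvPolynomial σ k) (y : G.ι (i + 1) → MvPolynomial σ k)
    (z : L.ι i → MvPolynomial σ k) :
    (coneD u v i).mulVec (Sum.elim (Sum.elim x y) z) =
      Sum.elim (Sum.elim ((F.d i).mulVec x + (u.f i).mulVec z)
        ((G.d i).mulVec y - (v.f i).mulVec z)) (-((shiftD L i).mulVec z)) := by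
  have h := Matrix.fromBlocks_mulVec (Matrix.fromBlocks (F.d i) 0 0 (G.d i))
    (Matrix.fromRows (u.f i) (-(v.f i))) 0 (-(shiftD L i)) (Sum.elim (Sum.elim x y) z)
  refine h.trans ?_
  rw [Matrix.fromBlocks_mulVec, Matrix.fromRows_mulVec, Matrix.zero_mulVec, Matrix.zero_mulVec,
    Matrix.zero_mulVec, add_zero, zero_add, zero_add, Matrix.neg_mulVec]
  refine funext fun p => ?_
  rcases p with (p | p) | p
  · rfl
  · exact (sub_eq_add_neg _ _).symm
  · exact congrFun (Matrix.neg_mulVec (v := z) (A := shiftD L i)) p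

theorem exists_sumElim {α β γ δ : Type*} (w : (α ⊕ β) ⊕ γ → δ) :
    ∃ x y z, w = Sum.elim (Sum.elim x y) z :=
  ⟨_, _, _, by rw [Sum.elim_comp_inl_inr, Sum.elim_comp_inl_inr]⟩

/-- The mapping cone of a lift of `J₁ ⊓ J₂ → J₁ ⊕ J₂` resolves `J₁ ⊔ J₂`. -/
theorem IsFreeResolution.cone {J₁ J₂ : Ideal (MvPolynomial σ k)} {L F G : MGComplex k σ}
    (hL : IsFreeResolution (J₁ ⊓ J₂) L) (hF : IsFreeResolution J₁ F) (hG : IsFreeResolution J₂ G)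
    (u : MGHom L F) (v : MGHom L G) : IsFreeResolution (J₁ ⊔ J₂) (cone u v) := by
  rw [isFreeResolution_iff] at hL hF hG ⊢
  obtain ⟨hL0, hL1, hL2⟩ := hL
  obtain ⟨hF0, hF1, hF2⟩ := hF
  obtain ⟨hG0, hG1, hG2⟩ := hG
  have hua : ∀ x, dotProduct F.aug ((u.f 0).mulVec x) = dotProduct L.aug x := fun x => by
    rw [Matrix.dotProduct_mulVec, u.aug_comm]
  have hva : ∀ x, dotProduct G.aug ((v.f 0).mulVec x) = dotProduct L.aug x := fun x => by
    rw [Matrix.dotProduct_mulVec, v.aug_comm]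
  have hud : ∀ i x, (u.f i).mulVec ((L.d i).mulVec x) = (F.d i).mulVec ((u.f (i + 1)).mulVec x) :=
    fun i x => by rw [Matrix.mulVec_mulVec, Matrix.mulVec_mulVec, u.comm]
  have hvd : ∀ i x, (v.f i).mulVec ((L.d i).mulVec x) = (G.d i).mulVec ((v.f (i + 1)).mulVec x) :=
    fun i x => by rw [Matrix.mulVec_mulVec, Matrix.mulVec_mulVec, v.comm]
  refine ⟨fun f => ?_, fun w hw => ?_, fun i w hw => ?_⟩
  · rw [Submodule.mem_sup]
    constructor
    · rintro ⟨g, hg, h, hh, rfl⟩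
      obtain ⟨x, rfl⟩ := (hF0 g).mp hg
      obtain ⟨y, rfl⟩ := (hG0 h).mp hh
      exact ⟨_, dotProduct_coneAug x y fun e => Empty.elim e⟩
    · rintro ⟨w, rfl⟩
      obtain ⟨x, y, z, rfl⟩ := exists_sumElim w
      exact ⟨_, (hF0 _).mpr ⟨x, rfl⟩, _, (hG0 _).mpr ⟨y, rfl⟩, (dotProduct_coneAug x y z).symm⟩
  · obtain ⟨x, y, z, rfl⟩ := exists_sumElim w
    have hxy : dotProduct F.aug x + dotProduct G.aug y = 0 :=
      (dotProduct_coneAug x y z).symm.trans hw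
    have hx : dotProduct F.aug x = -dotProduct G.aug y := eq_neg_of_add_eq_zero_left hxy
    -- The common value of `aug x` and `-aug y` lies in `J₁ ⊓ J₂`, so it lifts to `L`. As `v` enters
    -- the cone with a minus sign, `x - u t` and `y + v t` are then killed by the augmentations.
    obtain ⟨t, ht⟩ := (hL0 (dotProduct F.aug x)).mp
      ⟨(hF0 _).mpr ⟨x, rfl⟩, hx ▸ neg_mem ((hG0 _).mpr ⟨y, rfl⟩)⟩
    obtain ⟨x', hx'⟩ := hF1 (x - (u.f 0).mulVec t)
      (by rw [dotProduct_sub, hua, ht, sub_self])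
    obtain ⟨y', hy'⟩ := hG1 (y + (v.f 0).mulVec t)
      (by rw [dotProduct_add, hva, ht, hx, add_neg_cancel])
    refine ⟨Sum.elim (Sum.elim x' y') t, (coneD_mulVec u v 0 x' y' t).trans ?_⟩
    rw [hx', hy', sub_add_cancel, add_sub_cancel_right]
    exact congrArg _ (funext fun e => Empty.elim e)
  · obtain ⟨x, y, z, rfl⟩ : ∃ (x : F.ι (i + 1) → MvPolynomial σ k)
        (y : G.ι (i + 1) → MvPolynomial σ k) (z : L.ι i → MvPolynomial σ k),
        w = Sum.elim (Sum.elim x y) z := exists_sumElim w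
    have hw' := (coneD_mulVec u v i x y z).symm.trans hw
    have hx : (F.d i).mulVec x + (u.f i).mulVec z = 0 :=
      funext fun p => congrFun hw' (Sum.inl (Sum.inl p))
    have hy : (G.d i).mulVec y - (v.f i).mulVec z = 0 :=
      funext fun p => congrFun hw' (Sum.inl (Sum.inr p))
    have hz : -((shiftD L i).mulVec z) = 0 := funext fun p => congrFun hw' (Sum.inr p)
    have hz' : ∃ t, (L.d i).mulVec t = z := by
      -- In the bottom degree the shifted complex has no basis elements, so `hz` carries no
      -- information. That `z` has augmentation zero follows instead by augmenting `hx`. In higher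
      -- degrees `hz` says that `z` is a cycle.
      cases i with
      | zero =>
        refine hL1 z ?_
        rw [← hua, eq_neg_of_add_eq_zero_right hx, dotProduct_neg, Matrix.dotProduct_mulVec,
          F.aug_comp_d, zero_dotProduct, neg_zero]
      | succ i => exact hL2 i z (neg_eq_zero.mp hz)
    obtain ⟨t, rfl⟩ := hz'
    obtain ⟨x', hx'⟩ := hF2 i (x + (u.f (i + 1)).mulVec t)
      (by rw [Matrix.mulVec_add, ← hud, hx])
    obtain ⟨y', hy'⟩ := hG2 i (y - (v.f (i + 1)).mulVec t)
      (by rw [Matrix.mulVec_sub, ← hvd, hy])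
    -- The cone differential acts on the last summand by `-d`, so `-t` is the preimage of `d t`;
    -- this fixes the signs of the corrections by `u t` and `v t` in `x'` and `y'`.
    refine ⟨Sum.elim (Sum.elim x' y') (-t), (coneD_mulVec u v (i + 1) x' y' (-t)).trans ?_⟩
    rw [hx', hy', Matrix.mulVec_neg, Matrix.mulVec_neg, add_neg_cancel_right, sub_neg_eq_add,
      sub_add_cancel]
    refine congrArg _ ?_
    exact (congrArg Neg.neg (Matrix.mulVec_neg t (L.d i))).trans (neg_neg _)

theorem IsIteratedCone.isFreeResolution {I : Ideal (MvPolynomial σ k)} {F : MGComplex k σ}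
    (h : IsIteratedCone I F) : IsFreeResolution I F := by
  induction h with
  | single m => exact isFreeResolution_principal m
  | step I hI m hm _ L F _ _ u v ihL ihF =>
    rw [hI.eq_sup_pivot hm]
    exact ihL.cone ihF (isFreeResolution_principal m) u v
  | of_iso I F G _ h ih => exact ih.of_iso h

end Resolutions

/-! ### Isomorphisms from bijections of homogeneous bases -/

section Isomorphisms

variable {k : Type*} [Field k] {σ : Type*}

open Classical in
/-- The morphism of complexes given by a bijection between the homogeneous bases. -/
noncomputable def MGHom.ofEquiv {F G : MGComplex k σ} (e : ∀ i, G.ι i ≃ F.ι i)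
    (hdeg : ∀ i p, F.deg i (e i p) = G.deg i p)
    (hd : ∀ i p q, F.d i (e i p) (e (i + 1) q) = G.d i p q)
    (haug : ∀ p, F.aug (e 0 p) = G.aug p) : MGHom F G where
  f i := (1 : Matrix (F.ι i) (F.ι i) (MvPolynomial σ k)).submatrix (e i) id
  f_hom i p q := by
    rw [Matrix.submatrix_apply, Matrix.one_apply]
    split_ifs with h
    · have h' : F.deg i q = G.deg i p := by rw [← hdeg, h]; rfl
      exact Or.inr ⟨h'.ge, 1, by rw [h', tsub_self]; rfl⟩
    · exact Or.inl rfl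
  comm i := by
    ext1 p q
    have h : G.d i = (F.d i).submatrix (e i) (e (i + 1)) := by
      ext1 p q
      exact (hd i p q).symm
    simp [Matrix.mul_apply, Matrix.one_apply, h, ← (e (i + 1)).eq_symm_apply]
  aug_comm := by
    ext1 q
    simp [Matrix.vecMul, dotProduct, Matrix.one_apply, ← haug, ← (e 0).eq_symm_apply]

theorem MGIso.of_equiv {F G : MGComplex k σ} (e : ∀ i, G.ι i ≃ F.ι i)
    (hdeg : ∀ i p, F.deg i (e i p) = G.deg i p)
    (hd : ∀ i p q, F.d i (e i p) (e (i + 1) q) = G.d i p q)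
    (haug : ∀ p, F.aug (e 0 p) = G.aug p) : MGIso F G := by
  classical
  refine ⟨MGHom.ofEquiv e hdeg hd haug, MGHom.ofEquiv (fun i => (e i).symm)
    (fun i p => ?_) (fun i p q => ?_) (fun p => ?_), fun i => ⟨?_, ?_⟩⟩
  · rw [← hdeg, Equiv.apply_symm_apply]
  · rw [← hd, Equiv.apply_symm_apply, Equiv.apply_symm_apply]
  · rw [← haug, Equiv.apply_symm_apply]
  · ext1 p q
    simp [MGHom.ofEquiv, Matrix.mul_apply, Matrix.one_apply, (e i).symm_apply_eq]
  · ext1 p q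
    simp [MGHom.ofEquiv, Matrix.mul_apply, Matrix.one_apply, ← (e i).eq_symm_apply]

end Isomorphisms

/-! ### Polarization of chain maps, cones and iterated cones -/

section PolarizeComplex

variable {k : Type*} [Field k] {n : ℕ}

/-- Every summand is a scalar multiple of the one monomial `x^(ρ - μ)`, and likewise after
polarization with the same scalars. This is the functoriality of polarization. -/
theorem polEntry_sum_mul (a : Fin n → ℕ) {α : Type*} [Fintype α] {μ ρ : Fin n →₀ ℕ}
    (ν : α → Fin n →₀ ℕ) (f g : α → MvPolynomial (Fin n) k)
    (hf : ∀ x, IsHomEntry μ (ν x) (f x)) (hg : ∀ x, IsHomEntry (ν x) ρ (g x)) :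
    ∑ x, polEntry a μ (ν x) (f x) * polEntry a (ν x) ρ (g x) =
      polEntry a μ ρ (∑ x, f x * g x) := by
  rw [polEntry, coeff_sum, map_sum]
  refine Finset.sum_congr rfl fun x _ => ?_
  rw [(polEntry_hom a (hf x)).mul (polEntry_hom a (hg x)), (hf x).mul (hg x)]
  simp [polEntry]

theorem polEntry_neg (a : Fin n → ℕ) (μ ν : Fin n →₀ ℕ) (f : MvPolynomial (Fin n) k) :
    polEntry a μ ν (-f) = -polEntry a μ ν f := by
  simp [polEntry]

theorem polEntry_zero (a : Fin n → ℕ) (μ ν : Fin n →₀ ℕ) :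
    polEntry a μ ν (0 : MvPolynomial (Fin n) k) = 0 := by
  simp [polEntry]

/-- The polarization of a morphism of multigraded complexes. -/
noncomputable def MGHom.polarize (a : Fin n → ℕ) {F G : MGComplex k (Fin n)} (u : MGHom F G) :
    MGHom (F.polarize a) (G.polarize a) where
  f i := fun p q => polEntry a (G.deg i p) (F.deg i q) (u.f i p q)
  f_hom i p q := polEntry_hom a (u.f_hom i p q)
  comm i := by
    refine Matrix.ext fun (p : G.ι i) (q : F.ι (i + 1)) => ?_
    have h := congrFun₂ (u.comm i) p q
    exact (polEntry_sum_mul a (F.deg i) _ _ (u.f_hom i p) fun r => F.d_hom i r q).trans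
      ((congrArg _ h).trans (polEntry_sum_mul a (G.deg (i + 1)) _ _ (G.d_hom i p)
        fun r => u.f_hom (i + 1) r q).symm)
  aug_comm := by
    ext1 q
    exact (polEntry_sum_mul a (G.deg 0) _ _ G.aug_hom fun r => u.f_hom 0 r q).trans
      (congrArg _ (congrFun u.aug_comm q))

theorem MGIso.polarize (a : Fin n → ℕ) {F G : MGComplex k (Fin n)} (h : MGIso F G) :
    MGIso (F.polarize a) (G.polarize a) := by
  classical
  obtain ⟨u, v, huv⟩ := h
  have key : ∀ {F G : MGComplex k (Fin n)} (u : MGHom F G) (v : MGHom G F) (i : ℕ),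
      u.f i * v.f i = 1 → (u.polarize a).f i * (v.polarize a).f i = 1 := by
    intro F G u v i h
    refine Matrix.ext fun (p q : G.ι i) => ?_
    have h' : ∑ r, u.f i p r * v.f i r q = (1 : Matrix _ _ _) p q := congrFun₂ h p q
    refine (polEntry_sum_mul a (F.deg i) _ _ (u.f_hom i p) fun r => v.f_hom i r q).trans ?_
    rw [h', Matrix.one_apply]
    refine Eq.trans ?_ (Matrix.one_apply (i := p) (j := q)).symm
    -- On the diagonal both multidegrees agree, so the polarized monomial is `1`; off the diagonal
    -- the coefficient is zero.
    split_ifs with hpq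
    · subst hpq
      simp [polEntry]
    · exact polEntry_zero a _ _
  refine ⟨u.polarize a, v.polarize a, fun i => ⟨?_, ?_⟩⟩
  · exact key u v i (huv i).1
  · exact key v u i (huv i).2

theorem principal_polarize (a : Fin n → ℕ) (m : Fin n →₀ ℕ) :
    (principal k m).polarize a = principal k (pol a m) := by
  have hd : (fun i => ((principal k m).polarize a).d i) = fun i => (principal k (pol a m)).d i :=
    funext fun i => funext fun p => funext fun q => polEntry_zero a m m
  have haug : ((principal k m).polarize a).aug = (principal k (pol a m)).aug := by
    funext p
    change monomial (pol a m - pol a 0) (coeff (m - 0) (monomial m 1)) = monomial (pol a m) 1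
    simp [pol_zero]
  exact (MGComplex.mk.injEq ..).mpr ⟨rfl, HEq.rfl, HEq.rfl, heq_of_eq hd, heq_of_eq haug⟩

/-- The bijection between the bases of the shifted complex and of the shift of its
polarization. -/
def shiftPolarizeEquiv (a : Fin n → ℕ) (L : MGComplex k (Fin n)) :
    ∀ i, shiftι L i ≃ shiftι (L.polarize a) i
  | 0 => Equiv.refl _
  | _ + 1 => Equiv.refl _

/-- Entries match because `polEntry` preserves zero and signs. The shifted index types reduce to a
common type only once the degree is split into `0` and `i + 1`, hence an isomorphism rather than an
equality. -/
theorem cone_polarize_iso (a : Fin n → ℕ) {L F G : MGComplex k (Fin n)}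
    (u : MGHom L F) (v : MGHom L G) :
    MGIso (cone (u.polarize a) (v.polarize a)) ((cone u v).polarize a) := by
  refine MGIso.of_equiv (fun i => Equiv.sumCongr (Equiv.refl _) (shiftPolarizeEquiv a L i))
    (fun i p => ?_) (fun i p q => ?_) fun p => ?_
  · rcases p with (p | p) | p
    · rfl
    · rfl
    · cases i with
      | zero => exact Empty.elim p
      | succ i => rfl
  · rcases p with (p | p) | p <;> rcases q with (q | q) | q
    · rfl
    · exact (polEntry_zero a _ _).symm
    · rfl
    · exact (polEntry_zero a _ _).symm
    · rfl
    · exact (polEntry_neg a _ _ _).symm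
    · exact (polEntry_zero a _ _).symm
    · exact (polEntry_zero a _ _).symm
    · cases i with
      | zero => exact Empty.elim p
      | succ i => exact (polEntry_neg a _ _ _).symm
  · rcases p with (p | p) | p
    · rfl
    · rfl
    · exact Empty.elim p

theorem IsIteratedCone.polarize (a : Fin n → ℕ) {I : Ideal (MvPolynomial (Fin n) k)}
    {F : MGComplex k (Fin n)} (h : IsIteratedCone I F) (ha : ∀ s ∈ minGens I, ∀ i, s i ≤ a i) :
    IsIteratedCone (polarizeIdeal a I) (F.polarize a) := by
  induction h with
  | single m =>
    rw [polarizeIdeal_singleton, principal_polarize]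
    exact .single _
  | step I hI m hm hne L F _ _ u v ihL ihF =>
    have hL := ihL (le_of_mem_minGens_monomialIdeal_diff_inf ha hm)
    have hF := ihF (le_of_mem_minGens_monomialIdeal_diff ha m)
    rw [polarizeIdeal_inf_singleton, ← minGens_polarizeIdeal_diff a ha hm] at hL
    rw [polarizeIdeal_monomialIdeal, ← minGens_polarizeIdeal_diff a ha hm] at hF
    -- The target of `v.polarize a` equals `principal k (pol a m)` only propositionally;
    -- generalizing the target to `G` avoids a cast of the chain map.
    have hstep : ∀ {G : MGComplex k (PolVar a)}, G = principal k (pol a m) →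
        ∀ w : MGHom (L.polarize a) G,
          IsIteratedCone (polarizeIdeal a I) (cone (u.polarize a) w) := by
      rintro _ rfl w
      refine .step (polarizeIdeal a I) ⟨_, rfl⟩ (pol a m) ?_ ?_ _ _ hL hF _ w
      · rw [minGens_polarizeIdeal a ha]
        exact ⟨m, hm, rfl⟩
      · rw [minGens_polarizeIdeal_diff a ha hm]
        exact hne.image _
    exact .of_iso _ _ _ (hstep (principal_polarize a m) (v.polarize a)) (cone_polarize_iso a u v)
  | of_iso I F G _ h ih => exact .of_iso _ _ _ (ih ha) (h.polarize a)

end PolarizeComplex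

end MonPol

theorem corollary3p13 {k : Type*} [Field k] {n : ℕ} (I : Ideal (MvPolynomial (Fin n) k))
    (hI : MonPol.IsMonomialIdeal I) :
    (∀ F : MonPol.MGComplex k (Fin n), MonPol.IsConeResolution I F →
      MonPol.IsConeResolution (MonPol.polarization I) (F.polarize (MonPol.maxExp I))) ∧
    (∀ T : MonPol.LabeledTree (Ideal (MvPolynomial (Fin n) k)),
      MonPol.IsMayerVietorisTree I T →
      MonPol.IsMayerVietorisTree (MonPol.polarization I)
        (T.map (MonPol.polarizeIdeal (MonPol.maxExp I)))) := by
  refine ⟨fun F hF => ?_, fun T hT => hT.map_polarizeIdeal _ MonPol.le_maxExp⟩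
  have h := hF.2.polarize (MonPol.maxExp I) MonPol.le_maxExp
  exact ⟨h.isFreeResolution, h⟩
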